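/- Let $(X,d)$ be a complete separable metric space and let $\mu$ be a non-zero Borel measure on $X$ that is locally finite (every $x\in X$ has $r>0$ with $\mu(B(x,r))<\infty$); $\mu$ need not be a probability measure, nor finite. If there exists $N<0$ such that $(X,d,\mu)$ satisfies the reduced curvature-dimension condition $\mathrm{CD}^*(K,N)$ for every $K>0$, then $\operatorname{supp}\mu$ consists of exactly one point. Here $\mathcal P_2(X)$ is the set of Borel probability measures $\nu$ on $X$ with $\int_X d(x,x_0)^2\,d\nu(x)<\infty$ for some $x_0\in X$, and $$W_2(\nu,\nu')=\inf_{\pi}\Big(\int_{X\times X}d(x,y)^2\,d\pi(x,y)\Big)^{1/2},$$ the infimum being over all couplings $\pi$ of $\nu$ and $\nu'$; a coupling that attains it is called optimal. A geodesic from $\nu_0$ to $\nu_1$ in $(\mathcal P_2(X),W_2)$ is a family $(\nu_t)_{t\in[0,1]}$ in $\mathcal P_2(X)$ with these endpoints and $W_2(\nu_s,\nu_t)=|s-t|\,W_2(\nu_0,\nu_1)$ for all $s,t\in[0,1]$. For $N'<0$ the Rényi entropy of a Borel probability measure $\nu$ is $S_{N',\mu}(\nu)=\int_X\rho^{1-1/N'}\,d\mu$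 if $\nu=\rho\mu$, and $S_{N',\mu}(\nu)=\infty$ if $\nu$ is not absolutely continuous with respect to $\mu$. For $\kappa\in\mathbb R$ put $\omega_\kappa=\pi/\sqrt\kappa$ if $\kappa>0$ and $\omega_\kappa=\infty$ if $\kappa\le 0$. For $\theta>0$ put $s_\kappa(\theta)=\frac{\sin(\sqrt{\kappa}\,\theta)}{\sqrt{\kappa}\,\theta}$ if $\kappa>0$, $s_\kappa(\theta)=1$ if $\kappa=0$, and $s_\kappa(\theta)=\frac{\sinh(\sqrt{-\kappa}\,\theta)}{\sqrt{-\kappa}\,\theta}$ if $\kappa<0$; put $s_\kappa(0)=1$. For $t\in[0,1]$ put $\sigma_\kappa^{(t)}(\theta)=t\,s_\kappa(t\theta)/s_\kappa(\theta)$ if $0\le\theta<\omega_\kappa$, and $\sigma_\kappa^{(t)}(\theta)=\infty$ if $\theta\ge\omega_\kappa$. For $K\in\mathbb R$ and $N<0$, the space $(X,d,\mu)$ satisfies $\mathrm{CD}^*(K,N)$ if for all $\nu_0=\rho_0\mu$ and $\nu_1=\rho_1\mu$ in $\mathcal P_2(X)$ with $S_{N,\mu}(\nu_0)<\infty$ and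 $S_{N,\mu}(\nu_1)<\infty$ there exist a geodesic $(\nu_t)_{t\in[0,1]}$ from $\nu_0$ to $\nu_1$ in $(\mathcal P_2(X),W_2)$ and an optimal coupling $\pi$ of $\nu_0$ and $\nu_1$ such that $$S_{N',\mu}(\nu_t)\le\int_{X\times X}\Big(\sigma_{K/N'}^{(1-t)}(d(x_0,x_1))\,\rho_0(x_0)^{-1/N'}+\sigma_{K/N'}^{(t)}(d(x_0,x_1))\,\rho_1(x_1)^{-1/N'}\Big)\,d\pi(x_0,x_1)$$ for all $t\in[0,1]$ and all $N'\in[N,0)$ with $S_{N',\mu}(\nu_0)<\infty$ and $S_{N',\mu}(\nu_1)<\infty$. -/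

import Mathlib

open MeasureTheory

namespace MetricMeasure

noncomputable section

section Wasserstein

variable {X : Type*} [MetricSpace X] [MeasurableSpace X] [BorelSpace X]

/-- The set of couplings of two Borel probability measures. -/
def Cpl (μ ν : ProbabilityMeasure X) : Set (ProbabilityMeasure (X × X)) :=
  {π | (π : Measure (X × X)).map Prod.fst = (μ : Measure X) ∧
       (π : Measure (X × X)).map Prod.snd = (ν : Measure X)}

/-- The Borel probability measures with finite second moment. -/
def P2 (X : Type*) [MetricSpace X] [MeasurableSpace X] [BorelSpace X] :
    Set (ProbabilityMeasure X) :=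
  {μ | ∃ x₀ : X, ∫⁻ x, edist x x₀ ^ 2 ∂(μ : Measure X) < ⊤}

/-- The quadratic transport cost of a plan, `(∫ d(x, y)² dπ(x, y))^{1/2}`. -/
def transportCost (π : ProbabilityMeasure (X × X)) : ENNReal :=
  (∫⁻ z, edist z.1 z.2 ^ 2 ∂(π : Measure (X × X))) ^ (1 / 2 : ℝ)

/-- The `L²`-Wasserstein distance. It takes values in `[0, ∞]`, and is finite on `P2 X`. -/
def W2 (μ ν : ProbabilityMeasure X) : ENNReal :=
  ⨅ π ∈ Cpl μ ν, transportCost π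

/-- The set of optimal couplings: those that attain the infimum in `W2`. -/
def Opt (μ ν : ProbabilityMeasure X) : Set (ProbabilityMeasure (X × X)) :=
  {π | π ∈ Cpl μ ν ∧ transportCost π = W2 μ ν}

/-- `γ`, restricted to `[0, 1]`, is a (minimal, constant speed) geodesic from `ν₀` to `ν₁` in the
Wasserstein space `(P2 X, W2)`. The values of `γ` outside `[0, 1]` play no role. -/
structure IsW2Geodesic (γ : ℝ → ProbabilityMeasure X) (ν₀ ν₁ : ProbabilityMeasure X) : Prop where
  mem : ∀ t ∈ Set.Icc (0 : ℝ) 1, γ t ∈ P2 X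
  source : γ 0 = ν₀
  target : γ 1 = ν₁
  dist_eq : ∀ s ∈ Set.Icc (0 : ℝ) 1, ∀ t ∈ Set.Icc (0 : ℝ) 1,
    W2 (γ s) (γ t) = ENNReal.ofReal |s - t| * W2 ν₀ ν₁

end Wasserstein

section DistortionCoefficients

/-- `ω_κ = π / √κ` for `κ > 0`, and `ω_κ = ∞` for `κ ≤ 0`. -/
def omega (κ : ℝ) : ENNReal :=
  if 0 < κ then ENNReal.ofReal (Real.pi / √κ) else ⊤

/-- `s_κ(θ) = sin(√κ θ) / (√κ θ)` for `κ > 0`, `1` for `κ = 0`, and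
`sinh(√(-κ) θ) / (√(-κ) θ)` for `κ < 0`, extended by continuity by `s_κ(0) = 1`. -/
def sFun (κ θ : ℝ) : ℝ :=
  if θ = 0 then 1
  else if 0 < κ then Real.sin (√κ * θ) / (√κ * θ)
  else if κ = 0 then 1
  else Real.sinh (√(-κ) * θ) / (√(-κ) * θ)

/-- `σ_κ^{(t)}(θ) = t s_κ(tθ) / s_κ(θ)` for `0 ≤ θ < ω_κ`, and `∞` for `θ ≥ ω_κ`. -/
def sigmaFun (κ t θ : ℝ) : ENNReal :=
  if ENNReal.ofReal θ < omega κ then ENNReal.ofReal (t * (sFun κ (t * θ) / sFun κ θ)) else ⊤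

end DistortionCoefficients

section CurvatureDimension

variable {X : Type*} [MetricSpace X] [MeasurableSpace X] [BorelSpace X]

open Classical in
/-- The Rényi entropy `S_{N,μ}(ν) = ∫ ρ^{1 - 1/N} dμ` if `ν = ρ μ`, and `∞` if `ν` is not absolutely
continuous with respect to `μ`. A locally finite `μ` on a separable space is `σ`-finite, so that
`ν = ρ μ` for `ρ` the Radon-Nikodym derivative as soon as `ν ≪ μ`. -/
def renyiEntropy (N : ℝ) (μ : Measure X) (ν : ProbabilityMeasure X) : ENNReal :=
  if (ν : Measure X) ≪ μ then ∫⁻ x, ((ν : Measure X).rnDeriv μ x) ^ (1 - 1 / N) ∂μ else ⊤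

/-- The domain `D(S_{N,μ})` of the Rényi entropy. -/
def renyiDomain (N : ℝ) (μ : Measure X) : Set (ProbabilityMeasure X) :=
  {ν | renyiEntropy N μ ν < ⊤}

/-- The reduced curvature-dimension condition `CD*(K, N)` for a real `K` and `N < 0`. -/
def IsCDStar (μ : Measure X) (K N : ℝ) : Prop :=
  ∀ ν₀ ∈ P2 X ∩ renyiDomain N μ, ∀ ν₁ ∈ P2 X ∩ renyiDomain N μ,
    ∃ γ : ℝ → ProbabilityMeasure X, IsW2Geodesic γ ν₀ ν₁ ∧
      ∃ π ∈ Opt ν₀ ν₁,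
        ∀ t ∈ Set.Icc (0 : ℝ) 1, ∀ N' ∈ Set.Ico N 0,
          ν₀ ∈ renyiDomain N' μ → ν₁ ∈ renyiDomain N' μ →
          renyiEntropy N' μ (γ t) ≤
            (∫⁻ z, sigmaFun (K / N') (1 - t) (dist z.1 z.2) *
                ((ν₀ : Measure X).rnDeriv μ z.1) ^ (-1 / N') ∂(π : Measure (X × X))) +
            ∫⁻ z, sigmaFun (K / N') t (dist z.1 z.2) *
                ((ν₁ : Measure X).rnDeriv μ z.2) ^ (-1 / N') ∂(π : Measure (X × X))

end CurvatureDimension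

end

end MetricMeasure

namespace MetricMeasure

/-! ### Decay of the distortion coefficients -/

section Sigma

/-! Since `N < 0`, large `K > 0` makes `K / N` very negative, so the distortion coefficients are
ratios of `sinh` that tend to `0` uniformly for distances bounded below (`sigmaFun_neg_sq_le`). If
the support had two points, transport between uniform measures on small separated balls would
therefore have midpoints of arbitrarily small entropy, at any fixed time `t` in `(0, 1)`. For small
`t`, however, `γ t` is `W2`-close to its start and keeps most of its mass in a ball of finite
measure (`three_quarters_le_measure_ball`). Hölder then bounds its entropy below by a positive
constant (`exists_pos_le_renyiEntropy`). The geodesic varies with `K`, but `t` and this constant do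
not: contradiction as `K → ∞`. -/

theorem sinh_mul_div_sinh_le {s u : ℝ} (hs0 : 0 < s) (hs1 : s < 1) (hu : 0 < u) :
    Real.sinh (s * u) / Real.sinh u ≤ 1 / ((1 - s) * u) := by
  have hv : 0 < (1 - s) * u := mul_pos (by linarith) hu
  have hsu : 0 < Real.sinh (s * u) := Real.sinh_pos_iff.2 (mul_pos hs0 hu)
  -- Dropping the second summand leaves `sinh u ≥ sinh (s u) cosh ((1 - s) u)`, and `cosh v ≥ v`.
  have hsum : Real.sinh u = Real.sinh (s * u) * Real.cosh ((1 - s) * u)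
      + Real.cosh (s * u) * Real.sinh ((1 - s) * u) := by
    rw [← Real.sinh_add]; congr 1; ring
  have hcv : (1 - s) * u ≤ Real.cosh ((1 - s) * u) :=
    (Real.self_le_sinh_iff.2 hv.le).trans (Real.sinh_lt_cosh _).le
  have hpos : 0 < Real.cosh (s * u) * Real.sinh ((1 - s) * u) :=
    mul_pos (Real.cosh_pos _) (Real.sinh_pos_iff.2 hv)
  rw [div_le_div_iff₀ (Real.sinh_pos_iff.2 hu) hv]
  nlinarith [mul_le_mul_of_nonneg_left hcv hsu.le]

/-- For negative `κ = -M²` the distortion coefficients decay uniformly away from `θ = 0`. -/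
theorem sigmaFun_neg_sq_le {M s r θ : ℝ} (hM : 0 < M) (hs0 : 0 < s) (hs1 : s < 1) (hr : 0 < r)
    (hθ : r ≤ θ) :
    sigmaFun (-M ^ 2) s θ ≤ ENNReal.ofReal (1 / ((1 - s) * (M * r))) := by
  have hθ0 : 0 < θ := hr.trans_le hθ
  have hneg : -M ^ 2 < 0 := by nlinarith
  have hsq : √(-(-M ^ 2)) = M := by rw [neg_neg, Real.sqrt_sq hM.le]
  have hsh : 0 < Real.sinh (M * θ) := Real.sinh_pos_iff.2 (by positivity)
  have key : s * (sFun (-M ^ 2) (s * θ) / sFun (-M ^ 2) θ)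
      = Real.sinh (s * (M * θ)) / Real.sinh (M * θ) := by
    simp only [sFun, hθ0.ne', (mul_pos hs0 hθ0).ne', hneg.not_gt, hneg.ne, if_false, hsq]
    rw [show M * (s * θ) = s * (M * θ) by ring]
    field_simp
  simp only [sigmaFun, omega, hneg.not_gt, if_false, ENNReal.ofReal_lt_top, if_true]
  rw [key]
  refine ENNReal.ofReal_le_ofReal ((sinh_mul_div_sinh_le hs0 hs1 (by positivity)).trans ?_)
  have : 0 < 1 - s := by linarith
  gcongr

end Sigma

/-! ### Bounds for the Rényi entropy -/

section Entropy

variable {X : Type*} [MeasurableSpace X]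

/-- Hölder's inequality gives a lower bound for the Rényi entropy of a measure that charges a set
of finite measure. -/
theorem measure_le_renyiEntropy_rpow_mul {N : ℝ} (hN : N < 0) (μ : Measure X) [SigmaFinite μ]
    (ν : ProbabilityMeasure X) (hac : (ν : Measure X) ≪ μ) (B : Set X) :
    (ν : Measure X) B ≤
      renyiEntropy N μ ν ^ (1 / (1 - 1 / N)) * μ B ^ (1 / (1 - N)) := by
  have h1N : 1 / N < 0 := one_div_neg.2 hN
  have hpq : (1 - 1 / N).HolderConjugate (1 - N) := by
    rw [Real.holderConjugate_iff]
    refine ⟨by linarith, ?_⟩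
    have : 1 - N ≠ 0 := by linarith
    have : N - 1 ≠ 0 := by linarith
    have := hN.ne
    field_simp
    ring
  have hol := ENNReal.lintegral_mul_le_Lp_mul_Lq (μ.restrict B) hpq
    (f := (ν : Measure X).rnDeriv μ) (g := fun _ => 1)
    (Measure.measurable_rnDeriv _ _).aemeasurable aemeasurable_const
  simp only [Pi.mul_apply, mul_one, ENNReal.one_rpow, lintegral_const, one_mul,
    Measure.restrict_apply_univ] at hol
  rw [Measure.setLIntegral_rnDeriv hac] at hol
  refine hol.trans ?_
  rw [renyiEntropy, if_pos hac]
  gcongr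
  · have : 0 < 1 - 1 / N := by linarith
    positivity
  · exact Measure.restrict_le_self

/-- Solves the Hölder bound for the entropy. The constant is uniform in `ν`, as needed for geodesics
that change with `K`. -/
theorem exists_pos_le_renyiEntropy {N : ℝ} (hN : N < 0) (μ : Measure X) [SigmaFinite μ]
    {B : Set X} (hB : μ B ≠ ⊤) {a : ENNReal} (ha : 0 < a) :
    ∃ c : ENNReal, 0 < c ∧ ∀ ν : ProbabilityMeasure X, a ≤ (ν : Measure X) B →
      c ≤ renyiEntropy N μ ν := by
  have h1N : 1 / N < 0 := one_div_neg.2 hN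
  have hp : 0 < 1 - 1 / N := by linarith
  have hB' : μ B ^ (1 / (1 - N)) ≠ ⊤ :=
    ENNReal.rpow_ne_top_of_nonneg (one_div_nonneg.2 (by linarith)) hB
  refine ⟨min 1 ((a / μ B ^ (1 / (1 - N))) ^ (1 - 1 / N)), lt_min one_pos ?_, fun ν hν => ?_⟩
  · exact ENNReal.rpow_pos_of_nonneg (ENNReal.div_pos ha.ne' hB') hp.le
  by_cases hac : (ν : Measure X) ≪ μ
  · refine (min_le_right _ _).trans ?_
    have h := hν.trans (measure_le_renyiEntropy_rpow_mul hN μ ν hac B)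
    have h2 := ENNReal.rpow_le_rpow (ENNReal.div_le_of_le_mul h) hp.le
    rwa [← ENNReal.rpow_mul, one_div_mul_cancel hp.ne', ENNReal.rpow_one] at h2
  · rw [renyiEntropy, if_neg hac]; exact le_top

/-- The Rényi entropy of `ν` is the `ν`-integral of `ρ^{-1/N}`. -/
theorem lintegral_rnDeriv_rpow_eq_renyiEntropy {N : ℝ} (hN : N < 0) (μ : Measure X)
    [SigmaFinite μ] (ν : ProbabilityMeasure X) (hac : (ν : Measure X) ≪ μ) :
    ∫⁻ x, (ν : Measure X).rnDeriv μ x ^ (-1 / N) ∂(ν : Measure X) = renyiEntropy N μ ν := by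
  have h1N : 0 < -1 / N := div_pos_of_neg_of_neg (by norm_num) hN
  rw [renyiEntropy, if_pos hac, ← lintegral_rnDeriv_mul hac
    ((Measure.measurable_rnDeriv _ _).pow_const _).aemeasurable]
  refine lintegral_congr fun x => ?_
  rw [show 1 - 1 / N = 1 + -1 / N by ring,
    ENNReal.rpow_add_of_nonneg _ _ zero_le_one h1N.le, ENNReal.rpow_one]

/-- The normalized restriction of `μ` to a set of positive finite measure. -/
noncomputable def normalizedRestrict (μ : Measure X) (B : Set X) (h0 : μ B ≠ 0) (htop : μ B ≠ ⊤) :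
    ProbabilityMeasure X :=
  ⟨(μ B)⁻¹ • μ.restrict B, ⟨by simp [ENNReal.inv_mul_cancel h0 htop]⟩⟩

variable {μ : Measure X} {B : Set X} {h0 : μ B ≠ 0} {htop : μ B ≠ ⊤}

theorem normalizedRestrict_absolutelyContinuous :
    (normalizedRestrict μ B h0 htop : Measure X) ≪ μ :=
  Measure.absolutelyContinuous_of_le_smul (c := (μ B)⁻¹)
    (by
      change (μ B)⁻¹ • μ.restrict B ≤ _
      gcongr
      exact Measure.restrict_le_self)

theorem ae_mem_normalizedRestrict (hB : MeasurableSet B) :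
    ∀ᵐ x ∂(normalizedRestrict μ B h0 htop : Measure X), x ∈ B :=
  Measure.ae_smul_measure (ae_restrict_mem hB) _

/-- The density is at most `(μ B)⁻¹` and `-1 / N > 0`, so a bounded function is integrated against a
probability measure. -/
theorem normalizedRestrict_mem_renyiDomain [SigmaFinite μ] {N : ℝ} (hN : N < 0)
    (hB : MeasurableSet B) : normalizedRestrict μ B h0 htop ∈ renyiDomain N μ := by
  have h1N : 0 < -1 / N := div_pos_of_neg_of_neg (by norm_num) hN
  have hac := normalizedRestrict_absolutelyContinuous (h0 := h0) (htop := htop)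
  have hc : (μ B)⁻¹ ≠ ⊤ := ENNReal.inv_ne_top.2 h0
  have hd : (normalizedRestrict μ B h0 htop : Measure X).rnDeriv μ ≤ᵐ[μ] fun _ => (μ B)⁻¹ := by
    filter_upwards [Measure.rnDeriv_smul_left_of_ne_top' (μ.restrict B) μ hc,
      Measure.rnDeriv_restrict_self μ hB] with x h1 h2
    change ((μ B)⁻¹ • μ.restrict B).rnDeriv μ x ≤ _
    rw [h1, Pi.smul_apply, h2, smul_eq_mul]
    refine mul_le_of_le_one_right' (Set.indicator_le_self' (by simp) x)
  change renyiEntropy N μ _ < ⊤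
  rw [← lintegral_rnDeriv_rpow_eq_renyiEntropy hN μ _ hac]
  calc _ ≤ ∫⁻ _, (μ B)⁻¹ ^ (-1 / N) ∂(normalizedRestrict μ B h0 htop : Measure X) := by
        refine lintegral_mono_ae ?_
        filter_upwards [hac.ae_le hd] with x hx
        exact ENNReal.rpow_le_rpow hx h1N.le
    _ < ⊤ := by
        simp only [lintegral_const, measure_univ, mul_one]
        exact ENNReal.rpow_lt_top_of_nonneg h1N.le hc

end Entropy

/-! ### Couplings and Wasserstein estimates -/

section Transport

theorem ae_mem_of_mem_Cpl {X : Type*} [MeasurableSpace X]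
    {ν₀ ν₁ : ProbabilityMeasure X} {π : ProbabilityMeasure (X × X)}
    (hπ : π ∈ Cpl ν₀ ν₁) {p q : X → Prop} (hp : ∀ᵐ x ∂(ν₀ : Measure X), p x)
    (hq : ∀ᵐ x ∂(ν₁ : Measure X), q x) : ∀ᵐ z ∂(π : Measure (X × X)), p z.1 ∧ q z.2 := by
  rw [← hπ.1] at hp
  rw [← hπ.2] at hq
  exact (ae_of_ae_map measurable_fst.aemeasurable hp).and
    (ae_of_ae_map measurable_snd.aemeasurable hq)

variable {X : Type*} [MetricSpace X] [MeasurableSpace X] [BorelSpace X]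

theorem mem_P2_of_ae_ball {ν : ProbabilityMeasure X} {x : X} {r : ℝ}
    (h : ∀ᵐ y ∂(ν : Measure X), y ∈ Metric.ball x r) : ν ∈ P2 X := by
  refine ⟨x, ?_⟩
  calc _ ≤ ∫⁻ _, ENNReal.ofReal r ^ 2 ∂(ν : Measure X) := by
        refine lintegral_mono_ae ?_
        filter_upwards [h] with y hy
        gcongr
        rw [edist_dist]
        exact ENNReal.ofReal_le_ofReal (Metric.mem_ball.1 hy).le
    _ < ⊤ := by simp

/-- The product coupling already has finite cost. -/
theorem W2_lt_top_of_ae_ball {X : Type*} [MetricSpace X] [MeasurableSpace X]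
    {ν₀ ν₁ : ProbabilityMeasure X} {x y : X} {r : ℝ}
    (h₀ : ∀ᵐ z ∂(ν₀ : Measure X), z ∈ Metric.ball x r)
    (h₁ : ∀ᵐ z ∂(ν₁ : Measure X), z ∈ Metric.ball y r) : W2 ν₀ ν₁ < ⊤ := by
  have hmem : ν₀.prod ν₁ ∈ Cpl ν₀ ν₁ := by
    constructor <;> simp [ProbabilityMeasure.toMeasure_prod]
  refine (iInf₂_le _ hmem).trans_lt ?_
  refine ENNReal.rpow_lt_top_of_nonneg (by norm_num) (ne_of_lt ?_)
  calc _ ≤ ∫⁻ _, ENNReal.ofReal (r + dist x y + r) ^ 2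
          ∂(ν₀.prod ν₁ : ProbabilityMeasure (X × X)).toMeasure := by
        refine lintegral_mono_ae ?_
        filter_upwards [ae_mem_of_mem_Cpl hmem h₀ h₁] with z hz
        gcongr
        rw [edist_dist]
        refine ENNReal.ofReal_le_ofReal ?_
        have h1 := Metric.mem_ball.1 hz.1
        have h2 := Metric.mem_ball'.1 hz.2
        linarith [dist_triangle4 z.1 x y z.2]
    _ < ⊤ := by simp

/-- Markov's inequality: a measure that is `W2`-close to one living on `ball x r` gives little mass
to the complement of `ball x (2 * r)`. -/
theorem mul_measure_compl_ball_rpow_le_W2 [SecondCountableTopology X]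
    {ν₀ ν : ProbabilityMeasure X} {x : X} {r : ℝ}
    (h₀ : ∀ᵐ z ∂(ν₀ : Measure X), z ∈ Metric.ball x r) :
    ENNReal.ofReal r * (ν : Measure X) (Metric.ball x (2 * r))ᶜ ^ (1 / 2 : ℝ) ≤ W2 ν₀ ν := by
  refine le_iInf₂ fun π hπ => ?_
  have hms : MeasurableSet (Metric.ball x (2 * r))ᶜ := Metric.isOpen_ball.measurableSet.compl
  have hle : ENNReal.ofReal r ^ 2 * (ν : Measure X) (Metric.ball x (2 * r))ᶜ
      ≤ ∫⁻ z, edist z.1 z.2 ^ 2 ∂(π : Measure (X × X)) := by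
    rw [← hπ.2, Measure.map_apply measurable_snd hms,
      ← lintegral_indicator_const (measurable_snd hms)]
    refine lintegral_mono_ae ?_
    filter_upwards [ae_mem_of_mem_Cpl hπ h₀ (Filter.Eventually.of_forall fun _ => trivial)]
      with z hz
    by_cases hz2 : z ∈ Prod.snd ⁻¹' (Metric.ball x (2 * r))ᶜ
    swap
    · simp only [Set.indicator_of_notMem hz2, zero_le]
    rw [Set.indicator_of_mem hz2]
    gcongr
    rw [edist_dist]
    refine ENNReal.ofReal_le_ofReal ?_
    have h1 := Metric.mem_ball'.1 hz.1
    have h2 : 2 * r ≤ dist z.2 x := by simpa using hz2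
    rw [dist_comm] at h2
    linarith [dist_triangle x z.1 z.2]
  have h2 := ENNReal.rpow_le_rpow hle (z := 1 / 2) (by norm_num)
  rwa [ENNReal.mul_rpow_of_nonneg _ _ (by norm_num), ← ENNReal.rpow_natCast,
    ← ENNReal.rpow_mul, show ((2 : ℕ) : ℝ) * (1 / 2) = 1 by norm_num, ENNReal.rpow_one] at h2

theorem three_quarters_le_measure_ball [SecondCountableTopology X]
    {ν₀ ν : ProbabilityMeasure X} {x : X} {r : ℝ} (hr : 0 < r)
    (h₀ : ∀ᵐ z ∂(ν₀ : Measure X), z ∈ Metric.ball x r)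
    (h : W2 ν₀ ν ≤ ENNReal.ofReal (r / 2)) :
    ENNReal.ofReal (3 / 4) ≤ (ν : Measure X) (Metric.ball x (2 * r)) := by
  have hle := (mul_measure_compl_ball_rpow_le_W2 (ν := ν) h₀).trans h
  have hms : MeasurableSet (Metric.ball x (2 * r)) := Metric.isOpen_ball.measurableSet
  have hfin : (ν : Measure X) (Metric.ball x (2 * r)) ≠ ⊤ := measure_ne_top _ _
  have hcompl := prob_compl_eq_one_sub (μ := (ν : Measure X)) hms
  set m := (ν : Measure X) (Metric.ball x (2 * r))
  rw [hcompl, ← ENNReal.ofReal_toReal hfin, ← ENNReal.ofReal_one,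
    ← ENNReal.ofReal_sub _ ENNReal.toReal_nonneg] at hle
  have hm1 : m.toReal ≤ 1 := ENNReal.toReal_le_of_le_ofReal zero_le_one (by simpa using prob_le_one)
  rw [ENNReal.ofReal_rpow_of_nonneg (by linarith) (by norm_num), ← Real.sqrt_eq_rpow,
    ← ENNReal.ofReal_mul hr.le, ENNReal.ofReal_le_ofReal_iff (by positivity)] at hle
  -- Cancelling `r`; squaring then leaves at most `1 / 4` of the mass outside the ball.
  have h2 : √(1 - m.toReal) ≤ 1 / 2 := by nlinarith
  rw [Real.sqrt_le_left (by norm_num)] at h2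
  rw [← ENNReal.ofReal_toReal hfin]
  exact ENNReal.ofReal_le_ofReal (by norm_num at h2; linarith)

end Transport

/-! ### Large curvature forces a one-point support -/

section CurvatureDimension

theorem exists_small_radius {X : Type*} [MetricSpace X] [MeasurableSpace X]
    (μ : Measure X) [IsLocallyFiniteMeasure μ] (x : X) :
    ∃ ε > 0, ∀ r ≤ ε, μ (Metric.ball x r) ≠ ⊤ := by
  obtain ⟨s, hs, hfin⟩ := μ.finiteAt_nhds x
  obtain ⟨ε, hε, hsub⟩ := Metric.mem_nhds_iff.1 hs
  exact ⟨ε, hε, fun r hr =>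
    ((measure_mono ((Metric.ball_subset_ball hr).trans hsub)).trans_lt hfin).ne⟩

variable {X : Type*} [MetricSpace X] [MeasurableSpace X] [BorelSpace X]

/-- Along transports between measures at distance at least `r`, the condition `CD*(-N M², N)` makes
the entropy of intermediate measures small when `M` is large. -/
theorem IsCDStar.exists_geodesic_renyiEntropy_le {μ : Measure X} [SigmaFinite μ] {N M r t : ℝ}
    (hN : N < 0) (hM : 0 < M) (hr : 0 < r) (ht0 : 0 < t) (ht : t ≤ 1 / 2)
    (h : IsCDStar μ (-N * M ^ 2) N) {ν₀ ν₁ : ProbabilityMeasure X}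
    (h₀ : ν₀ ∈ P2 X ∩ renyiDomain N μ) (h₁ : ν₁ ∈ P2 X ∩ renyiDomain N μ)
    (hac₀ : (ν₀ : Measure X) ≪ μ) (hac₁ : (ν₁ : Measure X) ≪ μ)
    (hdist : ∀ π ∈ Cpl ν₀ ν₁, ∀ᵐ z ∂(π : Measure (X × X)), r ≤ dist z.1 z.2) :
    ∃ γ : ℝ → ProbabilityMeasure X, IsW2Geodesic γ ν₀ ν₁ ∧
      renyiEntropy N μ (γ t) ≤ ENNReal.ofReal (1 / (t * (M * r))) *
        (renyiEntropy N μ ν₀ + renyiEntropy N μ ν₁) := by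
  obtain ⟨γ, hγ, π, hπ, hle⟩ := h ν₀ h₀ ν₁ h₁
  refine ⟨γ, hγ, (hle t ⟨ht0.le, by linarith⟩ N ⟨le_rfl, hN⟩ h₀.2 h₁.2).trans ?_⟩
  have hκ : -N * M ^ 2 / N = -M ^ 2 := by field_simp [hN.ne]
  have hmeas : ∀ ν : ProbabilityMeasure X,
      Measurable fun x => (ν : Measure X).rnDeriv μ x ^ (-1 / N) :=
    fun ν => (Measure.measurable_rnDeriv _ _).pow_const _
  rw [hκ, mul_add]
  refine add_le_add ?_ ?_
  · rw [← lintegral_rnDeriv_rpow_eq_renyiEntropy hN μ ν₀ hac₀]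
    -- The entropy becomes an integral over `π`, comparable pointwise. The density's `ν₀` is
    -- rewritten too; the later `hπ.1.1` restores it.
    conv_rhs => rw [← hπ.1.1]
    rw [lintegral_map (by rw [hπ.1.1]; exact hmeas ν₀) measurable_fst, hπ.1.1,
      ← lintegral_const_mul _ (by exact (hmeas ν₀).comp measurable_fst)]
    refine lintegral_mono_ae ?_
    filter_upwards [hdist π hπ.1] with z hz
    gcongr
    simpa using sigmaFun_neg_sq_le (s := 1 - t) hM (by linarith) (by linarith) hr hz
  · rw [← lintegral_rnDeriv_rpow_eq_renyiEntropy hN μ ν₁ hac₁]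
    conv_rhs => rw [← hπ.1.2]
    rw [lintegral_map (by rw [hπ.1.2]; exact hmeas ν₁) measurable_snd, hπ.1.2,
      ← lintegral_const_mul _ (by exact (hmeas ν₁).comp measurable_snd)]
    refine lintegral_mono_ae ?_
    filter_upwards [hdist π hπ.1] with z hz
    gcongr
    -- Here the factor is `1 / (1 - t)`, at most `1 / t` because `t ≤ 1 / 2`.
    refine (sigmaFun_neg_sq_le hM ht0 (by linarith) hr hz).trans (ENNReal.ofReal_le_ofReal ?_)
    gcongr
    linarith

theorem subsingleton_support_of_forall_isCDStar [SecondCountableTopology X]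
    (μ : Measure X) [IsLocallyFiniteMeasure μ] {N : ℝ} (hN : N < 0)
    (hCD : ∀ K : ℝ, 0 < K → IsCDStar μ K N) : μ.support.Subsingleton := by
  intro x hx y hy
  by_contra hxy
  have hd : 0 < dist x y := dist_pos.2 hxy
  obtain ⟨ε₁, hε₁, hfin₁⟩ := exists_small_radius μ x
  obtain ⟨ε₂, hε₂, hfin₂⟩ := exists_small_radius μ y
  -- `2 * r` because the mass of `γ t` is only controlled in the doubled ball; `3 * r` keeps the two
  -- balls `r` apart.
  obtain ⟨r, hr, hr₁, hr₂, hrd⟩ : ∃ r > 0, 2 * r ≤ ε₁ ∧ r ≤ ε₂ ∧ 3 * r ≤ dist x y := by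
    refine ⟨min (ε₁ / 2) (min ε₂ (dist x y / 3)), by positivity, ?_, ?_, ?_⟩
    · linarith [min_le_left (ε₁ / 2) (min ε₂ (dist x y / 3))]
    · exact (min_le_right _ _).trans (min_le_left _ _)
    · linarith [(min_le_right (ε₁ / 2) _).trans (min_le_right ε₂ (dist x y / 3))]
  have hpos : ∀ z ∈ μ.support, μ (Metric.ball z r) ≠ 0 := fun z hz =>
    ((Measure.mem_support_iff_forall z).1 hz _ (Metric.ball_mem_nhds z hr)).ne'
  have hms : ∀ z : X, MeasurableSet (Metric.ball z r) := fun z => Metric.isOpen_ball.measurableSet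
  set ν₀ := normalizedRestrict μ (Metric.ball x r) (hpos x hx) (hfin₁ r (by linarith))
  set ν₁ := normalizedRestrict μ (Metric.ball y r) (hpos y hy) (hfin₂ r hr₂)
  have hae₀ : ∀ᵐ z ∂(ν₀ : Measure X), z ∈ Metric.ball x r := ae_mem_normalizedRestrict (hms x)
  have hae₁ : ∀ᵐ z ∂(ν₁ : Measure X), z ∈ Metric.ball y r := ae_mem_normalizedRestrict (hms y)
  have hS₀ : ν₀ ∈ renyiDomain N μ := normalizedRestrict_mem_renyiDomain hN (hms x)
  have hS₁ : ν₁ ∈ renyiDomain N μ := normalizedRestrict_mem_renyiDomain hN (hms y)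
  have hdist : ∀ π ∈ Cpl ν₀ ν₁, ∀ᵐ z ∂(π : Measure (X × X)), r ≤ dist z.1 z.2 := by
    intro π hπ
    filter_upwards [ae_mem_of_mem_Cpl hπ hae₀ hae₁] with z hz
    have h1 := Metric.mem_ball'.1 hz.1
    have h2 := Metric.mem_ball.1 hz.2
    linarith [dist_triangle4 x z.1 z.2 y]
  have hW : W2 ν₀ ν₁ ≠ ⊤ := (W2_lt_top_of_ae_ball hae₀ hae₁).ne
  set D := (W2 ν₀ ν₁).toReal
  have hD : 0 ≤ D := ENNReal.toReal_nonneg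
  -- The time is fixed before `M`, since `D` depends only on the endpoints.
  obtain ⟨t, ht0, ht, htD⟩ : ∃ t : ℝ, 0 < t ∧ t ≤ 1 / 2 ∧ t * D ≤ r / 2 := by
    refine ⟨min (1 / 2) (r / 2 / (D + 1)), by positivity, min_le_left _ _, ?_⟩
    calc _ ≤ r / 2 / (D + 1) * (D + 1) := by gcongr; exacts [min_le_right _ _, by linarith]
      _ = r / 2 := by field_simp
  obtain ⟨c, hc, hlow⟩ := exists_pos_le_renyiEntropy hN μ (hfin₁ (2 * r) hr₁)
    (a := ENNReal.ofReal (3 / 4)) (by simp)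
  set C := renyiEntropy N μ ν₀ + renyiEntropy N μ ν₁
  have hC : C ≠ ⊤ := ENNReal.add_ne_top.2 ⟨ne_of_lt hS₀, ne_of_lt hS₁⟩
  have hbound : ∀ M : ℝ, 0 < M → c ≤ ENNReal.ofReal (1 / (t * (M * r))) * C := by
    intro M hM
    obtain ⟨γ, hγ, hle⟩ := IsCDStar.exists_geodesic_renyiEntropy_le hN hM hr ht0 ht
      (hCD (-N * M ^ 2) (mul_pos (neg_pos.2 hN) (by positivity)))
      ⟨mem_P2_of_ae_ball hae₀, hS₀⟩ ⟨mem_P2_of_ae_ball hae₁, hS₁⟩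
      normalizedRestrict_absolutelyContinuous normalizedRestrict_absolutelyContinuous hdist
    refine (hlow (γ t) (three_quarters_le_measure_ball hr hae₀ ?_)).trans hle
    have h := hγ.dist_eq 0 (by simp) t ⟨ht0.le, by linarith⟩
    rw [hγ.source, zero_sub, abs_neg, abs_of_pos ht0, ← ENNReal.ofReal_toReal hW,
      ← ENNReal.ofReal_mul ht0.le] at h
    rw [h]
    exact ENNReal.ofReal_le_ofReal htD
  have hlim : Filter.Tendsto (fun M : ℝ => ENNReal.ofReal (1 / (t * (M * r))) * C)
      Filter.atTop (nhds 0) := by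
    have h1 : Filter.Tendsto (fun M : ℝ => 1 / (t * (M * r))) Filter.atTop (nhds 0) :=
      tendsto_const_nhds.div_atTop
        ((Filter.tendsto_id.atTop_mul_const hr).const_mul_atTop ht0)
    have h2 := ENNReal.Tendsto.mul_const (b := C) (ENNReal.tendsto_ofReal h1) (Or.inr hC)
    simpa using h2
  have := ge_of_tendsto hlim ((Filter.eventually_gt_atTop 0).mono hbound)
  exact hc.not_ge this

end CurvatureDimension

end MetricMeasure

theorem theorem8p1 {X : Type*} [MetricSpace X] [CompleteSpace X] [SecondCountableTopology X]
    [MeasurableSpace X] [BorelSpace X]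
    (μ : Measure X) [IsLocallyFiniteMeasure μ] (hμ : μ ≠ 0)
    (hCD : ∃ N : ℝ, N < 0 ∧ ∀ K : ℝ, 0 < K → MetricMeasure.IsCDStar μ K N) :
    ∃ x : X, μ.support = {x} := by
  obtain ⟨N, hN, hCD⟩ := hCD
  -- By second countability (Lindelöf), a measure with empty support vanishes.
  obtain ⟨x, hx⟩ := Measure.nonempty_support hμ
  exact ⟨x, (MetricMeasure.subsingleton_support_of_forall_isCDStar μ hN hCD).eq_singleton_of_mem hx⟩
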